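/- For integers $q,n\ge 1$ let $T_{q,n}$ be the positive $(q,n)$ torus link, i.e. the closure of the $q$-strand braid $(\sigma_1\sigma_2\cdots\sigma_{q-1})^n$ (where $\sigma_i$ is a positive crossing), with all strands oriented in parallel. For an oriented link $L$ let $\sigma(L)$ denote its signature, with the sign convention that $\sigma(L)\ge 0$ for positive knots; that is, if $V$ is a Seifert matrix of $L$, then $\sigma(L)$ is the number of negative eigenvalues minus the number of positive eigenvalues of $V+V^{T}$. (For the closed braid, $V$ is taken here to be the Seifert form of the surface obtained from Seifert's algorithm, with one disc for each strand and one half-twisted band for each crossing.) Put \[ a(q)=\begin{cases}1 & q \text{ odd}\\ 2 & q\text{ even}\end{cases}\qquad\text{and}\qquad b(q,n)=\begin{cases}\tfrac12 & q\text{ odd and } n \text{ even}\\ 0&\text{otherwise.}\end{cases} \] Then for all integers $1\le q\le n$, \[ \frac{(q-1)n}{2}\;\le\;\sigma(T_{q,n})\;\le\;\frac{q(n+1)}{2}-a(q)-b(q,n). \] -/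

import Mathlib

/-- A braid word on `q` strands: a finite sequence of letters, the `t`-th letter being
`σ_{i+1}` or its inverse, where `i = gen t` ranges over `0, …, q - 2` and the exponent is
`sign t`. The letter `σ_{i+1}` (exponent `1`) is a positive crossing between the strands at
positions `i` and `i + 1`. Its closure is an oriented link, all strands being oriented in the same
direction around the braid axis, and every oriented link in `S³` is of this form. -/
structure BraidWord (q : ℕ) where
  /-- the number of letters -/
  length : ℕ
  /-- the index of the generator at each place -/
  gen : Fin length → Fin (q - 1)
  /-- the exponent `1` or `-1`, which is the sign of the crossing, at each place -/
  sign : Fin length → ℤˣ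

/-! Seifert's algorithm, applied to the closure of a braid word `w` on `q` strands, gives the
following Seifert surface `F`. There are `q` horizontal discs `D_0, …, D_{q-1}` of the same radius,
stacked above each other in this order around the vertical braid axis, all oriented by the upward
normal, so that their boundaries run counterclockwise. For the letter at place `t`, with generator
index `i`, a band with one half twist (of the sign of the crossing) joins the boundary of `D_i` to
the boundary of `D_{i+1}`, at an angle that increases with `t`. The oriented boundary of `F` is the
closed braid. (If a generator does not occur in `w`, then `F` is disconnected; joining its pieces by
tubes would change the symmetrized Seifert form only by zero summands.)

`F` retracts onto the graph with one vertex for every disc (its centre) and one edge for every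
letter (a radius of `D_i`, the core of the band, a radius of `D_{i+1}`), which is oriented from
`D_i` to `D_{i+1}`. A real `1`-chain of this graph is a function `x : Fin w.length → ℝ`. -/

namespace BraidWord

variable {q : ℕ}

/-- The part of the chain `x` in the disc `D_d`, recorded by the amount that flows from the
centre of `D_d` outwards to the foot of the band `t`, for every `t`. -/
def outflow (w : BraidWord q) (x : Fin w.length → ℝ) (d : Fin q) (t : Fin w.length) : ℝ :=
  (if (w.gen t : ℕ) = d then x t else 0) - (if (w.gen t : ℕ) + 1 = d then x t else 0)

/-- The first homology `H₁(F; ℝ)` of the Seifert surface: the cycles of the graph, that is, the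
chains for which the total flow out of the centre of each disc vanishes. -/
def homology (w : BraidWord q) : Submodule ℝ (Fin w.length → ℝ) where
  carrier := {x | ∀ d : Fin q, ∑ t, w.outflow x d t = 0}
  zero_mem' := by
    intro d
    simp [outflow]
  add_mem' := by
    intro x y hx hy d
    have h : ∀ t, w.outflow (x + y) d t = w.outflow x d t + w.outflow y d t := by
      intro t
      simp only [outflow, Pi.add_apply]
      split_ifs <;> ring
    simp only [h, Finset.sum_add_distrib, hx d, hy d, add_zero]
  smul_mem' := by
    intro c x hx d
    have h : ∀ t, w.outflow (c • x) d t = c * w.outflow x d t := by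
      intro t
      simp only [outflow, Pi.smul_apply, smul_eq_mul]
      split_ifs <;> ring
    simp only [h, ← Finset.mul_sum, hx d, mul_zero]

/-- The signed number of crossings, seen from above, of two flows in a disc, of which the second
passes below the first: `f t` and `g t` are the amounts that flow from the centre to the boundary
point `t`, and these points are passed counterclockwise as `t` increases. (A crossing is counted
with the sign of the determinant of the upper and the lower direction. For arcs from `t'` to `t`
and from `s'` to `s` with distinct ends this is `1` if they are met in the cyclic order
`t, s, t', s'`, it is `-1` if they are met in the order `t, s', t', s`, and `0` if the arcs are
disjoint; common ends are shared out evenly to both sides.) -/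
noncomputable def crossingNumber {N : ℕ} (f g : Fin N → ℝ) : ℝ :=
  ∑ t, ∑ s, if t < s then (f t * g s - f s * g t) / 2 else 0

/-- The linking number `lk(x, y⁺)`, where `y⁺` is the cycle `y` pushed off `F` in the direction of
the positive normal. It is the signed number of crossings, seen from above, where `y⁺` passes over
`x`. The part of `y⁺` in the disc `D_e` passes over the part of `x` in `D_d` exactly if `d ≤ e`.
In a band, the push-off of the core passes half a time around the core; in a positive band this
counts `-1/2`: the core of an annulus with two positive half twists, whose boundary is the positive
Hopf link, has linking number `-1` with its push-off. -/
noncomputable def linkingNumber (w : BraidWord q) (x y : Fin w.length → ℝ) : ℝ :=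
  (∑ d : Fin q, ∑ e : Fin q,
    if d ≤ e then crossingNumber (w.outflow y e) (w.outflow x d) else 0)
  - ∑ t, ((w.sign t : ℤ) : ℝ) / 2 * (x t * y t)

theorem outflow_add (w : BraidWord q) (x y : Fin w.length → ℝ) (d : Fin q) :
    w.outflow (x + y) d = w.outflow x d + w.outflow y d := by
  funext t
  simp only [outflow, Pi.add_apply]
  split_ifs <;> ring

theorem outflow_smul (w : BraidWord q) (c : ℝ) (x : Fin w.length → ℝ) (d : Fin q) :
    w.outflow (c • x) d = c • w.outflow x d := by
  funext t
  simp only [outflow, Pi.smul_apply, smul_eq_mul]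
  split_ifs <;> ring

theorem crossingNumber_add_left {N : ℕ} (f f' g : Fin N → ℝ) :
    crossingNumber (f + f') g = crossingNumber f g + crossingNumber f' g := by
  simp only [crossingNumber, ← Finset.sum_add_distrib, Pi.add_apply]
  refine Finset.sum_congr rfl fun t _ => Finset.sum_congr rfl fun s _ => ?_
  split_ifs <;> ring

theorem crossingNumber_add_right {N : ℕ} (f g g' : Fin N → ℝ) :
    crossingNumber f (g + g') = crossingNumber f g + crossingNumber f g' := by
  simp only [crossingNumber, ← Finset.sum_add_distrib, Pi.add_apply]
  refine Finset.sum_congr rfl fun t _ => Finset.sum_congr rfl fun s _ => ?_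
  split_ifs <;> ring

theorem crossingNumber_smul_left {N : ℕ} (c : ℝ) (f g : Fin N → ℝ) :
    crossingNumber (c • f) g = c * crossingNumber f g := by
  simp only [crossingNumber, Finset.mul_sum, Pi.smul_apply, smul_eq_mul]
  refine Finset.sum_congr rfl fun t _ => Finset.sum_congr rfl fun s _ => ?_
  split_ifs <;> ring

theorem crossingNumber_smul_right {N : ℕ} (c : ℝ) (f g : Fin N → ℝ) :
    crossingNumber f (c • g) = c * crossingNumber f g := by
  simp only [crossingNumber, Finset.mul_sum, Pi.smul_apply, smul_eq_mul]
  refine Finset.sum_congr rfl fun t _ => Finset.sum_congr rfl fun s _ => ?_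
  split_ifs <;> ring

theorem linkingNumber_add_left (w : BraidWord q) (x x' y : Fin w.length → ℝ) :
    w.linkingNumber (x + x') y = w.linkingNumber x y + w.linkingNumber x' y := by
  simp only [linkingNumber, outflow_add, crossingNumber_add_right, Pi.add_apply, add_mul, mul_add,
    ite_add_zero, Finset.sum_add_distrib]
  ring

theorem linkingNumber_add_right (w : BraidWord q) (x y y' : Fin w.length → ℝ) :
    w.linkingNumber x (y + y') = w.linkingNumber x y + w.linkingNumber x y' := by
  simp only [linkingNumber, outflow_add, crossingNumber_add_left, Pi.add_apply, mul_add,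
    ite_add_zero, Finset.sum_add_distrib]
  ring

theorem linkingNumber_smul_left (w : BraidWord q) (c : ℝ) (x y : Fin w.length → ℝ) :
    w.linkingNumber (c • x) y = c * w.linkingNumber x y := by
  simp only [linkingNumber, outflow_smul, crossingNumber_smul_right, Pi.smul_apply, smul_eq_mul,
    mul_sub, Finset.mul_sum, mul_ite, mul_zero]
  congr 1
  exact Finset.sum_congr rfl fun t _ => by ring

theorem linkingNumber_smul_right (w : BraidWord q) (c : ℝ) (x y : Fin w.length → ℝ) :
    w.linkingNumber x (c • y) = c * w.linkingNumber x y := by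
  simp only [linkingNumber, outflow_smul, crossingNumber_smul_left, Pi.smul_apply, smul_eq_mul,
    mul_sub, Finset.mul_sum, mul_ite, mul_zero]
  congr 1
  exact Finset.sum_congr rfl fun t _ => by ring

/-- The Seifert form `V(x, y) = lk(x, y⁺)` on `H₁(F; ℝ)`. -/
noncomputable def seifertForm (w : BraidWord q) : LinearMap.BilinForm ℝ w.homology :=
  LinearMap.mk₂ ℝ (fun x y => w.linkingNumber x y)
    (fun x x' y => w.linkingNumber_add_left x x' y)
    (fun c x y => w.linkingNumber_smul_left c x y)
    (fun x y y' => w.linkingNumber_add_right x y y')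
    (fun c x y => w.linkingNumber_smul_right c x y)

/-- The signature of the closure of the braid word `w`: the signature of the symmetrized Seifert
form `V + Vᵀ`, with the sign that makes it nonnegative for positive knots, that is, the number of
negative minus the number of positive eigenvalues of `V + Vᵀ`. -/
noncomputable def signature (w : BraidWord q) : ℤ :=
  (sigNeg (w.seifertForm + w.seifertForm.flip).toQuadraticMap : ℤ)
    - (sigPos (w.seifertForm + w.seifertForm.flip).toQuadraticMap : ℤ)

end BraidWord

/-- The braid word `(σ₁ σ₂ ⋯ σ_{q-1})ⁿ`, whose closure is the positive torus link `T_{q,n}`: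
it has `n (q - 1)` letters, all with exponent `1`, and the index of the generator at place
`t` (counted from `0`) is `t mod (q - 1)`. -/
def torusLink (q n : ℕ) : BraidWord q where
  length := n * (q - 1)
  gen := fun t => t.modNat
  sign := fun _ => 1

/-- `a(q)` is `1` for odd `q` and `2` for even `q`. -/
def aTerm (q : ℕ) : ℝ := if Odd q then 1 else 2

/-- `b(q, n)` is `1/2` if `q` is odd and `n` is even, and `0` otherwise. -/
noncomputable def bTerm (q n : ℕ) : ℝ := if Odd q ∧ Even n then 1 / 2 else 0

/-!
The letters of the torus braid word form an `n × (q - 1)` array, so a chain is a family of *layers*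
`x_e : ℕ → ℝ`, `e < q - 1`, one for each generator, and it is a cycle when each layer sums to zero
(`mem_homology_torusLink_iff`). On cycles the symmetrised Seifert form is `-⟨x, y⟩` plus a coupling
of consecutive layers (`linkingNumber_add_linkingNumber`), and this coupling is discrete
integration in the cyclic direction `ℤ/n`. It is therefore diagonalised by Fourier analysis: a
real wave (`cos + sin`) of frequency `j` in the direction of `ℤ/n`, with a phase that grows
linearly with the layer, times a sine of frequency `i` across the layers. These chains
(`eigenchain`) form an orthogonal basis of the homology, and the value of the form on the `(i, j)`
chain has the sign of `cos (π i / q) - sin (π j / n)` (`two_mul_sin_mul_linkingNumber`). By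
Sylvester's law of inertia, the signature is a count of signs, which comes down to a count of
lattice points in a right triangle (`signature_torusLink`):
`σ(T_{q,n}) = (q - 1)(n - 1) - 2 L`, where `L` counts the pairs of positive
integers with `i/q + j/n < 1/2` twice and those with `i/q + j/n = 1/2` once.

This count is symmetric in `q` and `n`, and counting along lines gives the recursions of Gordon,
Litherland and Murasugi: for `q` odd,
`σ(q, n + 2q) = σ(q, n) + q² - 1` and `σ(q, n) + σ(q, 2q - n) = q² - 1`, and similarly for `q` even
(`torusSignature_add_two_mul`, `torusSignature_add_torusSignature`). Each of them, together with the
symmetry, reduces the two bounds for `(q, n)` to those for a smaller pair, the second one exchanging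
the lower and the upper bound (`torusSignature_bounds`).
-/

/-! ### Counting lattice points in a triangle -/

/-- The number of pairs `(i, j)` of positive integers with `i/q + j/n < 1/2` plus the number of those
with `i/q + j/n ≤ 1/2`. The summation variables are `i - 1` and `j - 1`. -/
def cornerCount (q n : ℕ) : ℕ :=
  ∑ i ∈ Finset.range (q - 1), ∑ j ∈ Finset.range (n - 1),
    ((if 2 * ((i + 1) * n + (j + 1) * q) < q * n then 1 else 0) +
      (if 2 * ((i + 1) * n + (j + 1) * q) ≤ q * n then 1 else 0))

theorem cornerCount_comm (q n : ℕ) : cornerCount q n = cornerCount n q := by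
  rw [cornerCount, cornerCount, Finset.sum_comm]
  refine Finset.sum_congr rfl fun j _ => Finset.sum_congr rfl fun i _ => ?_
  rw [add_comm ((i + 1) * n), mul_comm q n]

theorem sum_range_ite_mul_le {q n m : ℕ} (hq : 0 < q) (hm : m ≤ q * n) (hn : 0 < n) :
    ∑ j ∈ Finset.range (n - 1), (if 2 * q * (j + 1) ≤ m then 1 else 0) = m / (2 * q) := by
  rw [← Finset.sum_filter, Finset.sum_const, smul_eq_mul, mul_one]
  have h : (Finset.range (n - 1)).filter (fun j => 2 * q * (j + 1) ≤ m)
      = Finset.range (m / (2 * q)) := by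
    ext j
    simp only [Finset.mem_filter, Finset.mem_range]
    have key : 2 * q * (j + 1) ≤ m ↔ j < m / (2 * q) := by
      rw [Nat.lt_iff_add_one_le, Nat.le_div_iff_mul_le (by positivity), mul_comm]
    rw [key]
    refine ⟨fun h => h.2, fun h => ⟨?_, h⟩⟩
    rw [← key] at h
    by_contra hc
    have h1 : n ≤ j + 1 := by omega
    have h2 : q * n ≤ q * (j + 1) := Nat.mul_le_mul_left _ h1
    have h3 : 0 < q * (j + 1) := by positivity
    nlinarith
  rw [h, Finset.card_range]

/-- The lattice points on the line of a fixed `i` are counted by a quotient. When `q ≤ 2 i` the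
truncated difference `q - 2 i` is `0`, as is the number of lattice points. -/
theorem cornerCount_eq_sum_div {q n : ℕ} (hn : 0 < n) :
    cornerCount q n = ∑ i ∈ Finset.range (q - 1),
      (n * (q - 2 * (i + 1)) / (2 * q) + (n * (q - 2 * (i + 1)) - 1) / (2 * q)) := by
  refine Finset.sum_congr rfl fun i hi => ?_
  have hi' := Finset.mem_range.1 hi
  have hq : 0 < q := by omega
  have hm : n * (q - 2 * (i + 1)) ≤ q * n := by
    rw [mul_comm]; exact Nat.mul_le_mul_right _ (Nat.sub_le _ _)
  rw [Finset.sum_add_distrib, add_comm, ← sum_range_ite_mul_le hq hm hn,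
    ← sum_range_ite_mul_le hq ((Nat.sub_le _ 1).trans hm) hn]
  rw [Nat.mul_sub]
  congr 1 <;> refine Finset.sum_congr rfl fun j _ => if_congr ?_ rfl rfl
  · have h : 0 < q * (j + 1) := by positivity
    have e1 : n * q = q * n := mul_comm _ _
    have e2 : n * (2 * (i + 1)) = 2 * ((i + 1) * n) := by ring
    have e3 : 2 * q * (j + 1) = 2 * (q * (j + 1)) := by ring
    have e4 : (j + 1) * q = q * (j + 1) := by ring
    rw [e1, e2, e3, e4]; omega
  · have h : 0 < q * (j + 1) := by positivity
    have e1 : n * q = q * n := mul_comm _ _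
    have e2 : n * (2 * (i + 1)) = 2 * ((i + 1) * n) := by ring
    have e3 : 2 * q * (j + 1) = 2 * (q * (j + 1)) := by ring
    have e4 : (j + 1) * q = q * (j + 1) := by ring
    rw [e1, e2, e3, e4]; omega

theorem cornerCount_add_two_mul {q n : ℕ} (hn : 0 < n) :
    cornerCount q (n + 2 * q) =
      cornerCount q n + 2 * ∑ i ∈ Finset.range (q - 1), (q - 2 * (i + 1)) := by
  rw [cornerCount_eq_sum_div (by omega), cornerCount_eq_sum_div hn, Finset.mul_sum,
    ← Finset.sum_add_distrib]
  refine Finset.sum_congr rfl fun i hi => ?_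
  have hi' := Finset.mem_range.1 hi
  generalize q - 2 * (i + 1) = K
  rcases Nat.eq_zero_or_pos K with rfl | hK
  · simp
  have h : 0 < n * K := by positivity
  have e : (n + 2 * q) * K - 1 = (n * K - 1) + 2 * q * K := by
    rw [add_mul]; omega
  rw [e, add_mul, Nat.add_mul_div_left _ _ (by omega), Nat.add_mul_div_left _ _ (by omega)]
  ring

/-- The case `n = 0` of `cornerCount_add_two_mul`, with a correction: for `n = 2q` each line with
`2 i < q` ends in a lattice point on the hypotenuse, which is counted only once. -/
theorem cornerCount_two_mul (q : ℕ) :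
    cornerCount q (2 * q) = ∑ i ∈ Finset.range (q - 1),
      ((q - 2 * (i + 1)) + (q - 2 * (i + 1) - 1)) := by
  rcases Nat.eq_zero_or_pos q with rfl | hq
  · rfl
  rw [cornerCount_eq_sum_div (by omega)]
  refine Finset.sum_congr rfl fun i hi => ?_
  generalize q - 2 * (i + 1) = K
  rcases Nat.eq_zero_or_pos K with rfl | hK
  · simp
  rw [Nat.mul_div_cancel_left _ (by omega)]
  congr 1
  have e : 2 * q * K - 1 = (2 * q - 1) + 2 * q * (K - 1) := by
    obtain ⟨k, rfl⟩ : ∃ k, K = k + 1 := ⟨K - 1, by omega⟩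
    rw [mul_add, Nat.add_sub_cancel]; omega
  rw [e, Nat.add_mul_div_left _ _ (by omega), Nat.div_eq_of_lt (by omega), zero_add]

theorem div_add_div_of_add_eq {d a b K : ℕ} (hb : 0 < b) (h : a + b = d * K) :
    a / d + (b - 1) / d = K - 1 := by
  have hd : 0 < d := by
    rcases Nat.eq_zero_or_pos d with rfl | hd
    · omega
    · exact hd
  have hr := Nat.mod_lt a hd
  have ha := Nat.div_add_mod a d
  have hK : a / d < K := by
    rw [Nat.div_lt_iff_lt_mul hd, mul_comm]; omega
  obtain ⟨k, rfl⟩ : ∃ k, K = a / d + k + 1 := ⟨K - a / d - 1, by omega⟩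
  have e : b - 1 = (d - 1 - a % d) + d * k := by
    rw [mul_add, mul_add, mul_one] at h; omega
  rw [e, Nat.add_mul_div_left _ _ hd, Nat.div_eq_of_lt (show d - 1 - a % d < d by omega)]
  rw [zero_add, Nat.add_sub_cancel]

theorem cornerCount_add_cornerCount {q n m : ℕ} (hn : 0 < n) (hm : 0 < m) (h : n + m = 2 * q) :
    cornerCount q n + cornerCount q m =
      2 * ∑ i ∈ Finset.range (q - 1), (q - 2 * (i + 1) - 1) := by
  rw [cornerCount_eq_sum_div hn, cornerCount_eq_sum_div hm, Finset.mul_sum,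
    ← Finset.sum_add_distrib]
  refine Finset.sum_congr rfl fun i _ => ?_
  generalize q - 2 * (i + 1) = K
  rcases Nat.eq_zero_or_pos K with rfl | hK
  · simp
  have h1 := div_add_div_of_add_eq (d := 2 * q) (K := K) (Nat.mul_pos hm hK)
    (by rw [← h, ← add_mul] : n * K + m * K = _)
  have h2 := div_add_div_of_add_eq (d := 2 * q) (K := K) (Nat.mul_pos hn hK)
    (by rw [← h, ← add_mul, add_comm] : m * K + n * K = _)
  omega

theorem sum_range_sub_two_mul (q : ℕ) :
    (∑ i ∈ Finset.range (q - 1), ((q - 2 * (i + 1) : ℕ) : ℤ)) * 4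
      = if Odd q then ((q : ℤ) - 1) ^ 2 else (q : ℤ) * (q - 2) := by
  induction q using Nat.strong_induction_on with
  | _ q ih =>
  rcases q with _ | _ | _ | q
  · simp
  · simp
  · simp
  · have h := ih (q + 1) (by omega)
    have e : ∑ i ∈ Finset.range (q + 3 - 1), ((q + 3 - 2 * (i + 1) : ℕ) : ℤ)
        = (q + 1) + ∑ i ∈ Finset.range (q + 1 - 1), ((q + 1 - 2 * (i + 1) : ℕ) : ℤ) := by
      rw [show q + 3 - 1 = q + 1 + 1 by omega, Finset.sum_range_succ', Finset.sum_range_succ,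
        show q + 1 - 1 = q by omega, add_comm]
      congr 1
      rw [show q + 3 - 2 * (q + 1 + 1) = 0 by omega, Nat.cast_zero, add_zero]
      refine Finset.sum_congr rfl fun i _ => ?_
      congr 1; omega
    rw [show q + 1 + 1 + 1 = q + 3 by ring, e, add_mul, h]
    have : Odd (q + 3) ↔ Odd (q + 1) := by grind
    simp only [this]
    split_ifs <;> push_cast <;> ring

theorem sum_range_sub_two_mul_sub_one (q : ℕ) (hq : 0 < q) :
    (∑ i ∈ Finset.range (q - 1), ((q - 2 * (i + 1) - 1 : ℕ) : ℤ)) * 4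
      = if Odd q then ((q : ℤ) - 1) * (q - 3) else ((q : ℤ) - 2) ^ 2 := by
  induction q using Nat.strong_induction_on with
  | _ q ih =>
  rcases q with _ | _ | _ | q
  · simp at hq
  · simp
  · simp
  · have h := ih (q + 1) (by omega) (by omega)
    have e : ∑ i ∈ Finset.range (q + 3 - 1), ((q + 3 - 2 * (i + 1) - 1 : ℕ) : ℤ)
        = q + ∑ i ∈ Finset.range (q + 1 - 1), ((q + 1 - 2 * (i + 1) - 1 : ℕ) : ℤ) := by
      rw [show q + 3 - 1 = q + 1 + 1 by omega, Finset.sum_range_succ', Finset.sum_range_succ,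
        show q + 1 - 1 = q by omega, add_comm]
      congr 1
      rw [show q + 3 - 2 * (q + 1 + 1) - 1 = 0 by omega, Nat.cast_zero, add_zero]
      refine Finset.sum_congr rfl fun i _ => ?_
      congr 1; omega
    rw [show q + 1 + 1 + 1 = q + 3 by ring, e, add_mul, h]
    have : Odd (q + 3) ↔ Odd (q + 1) := by grind
    simp only [this]
    split_ifs <;> push_cast <;> ring

/-! ### Recursions and bounds for the lattice point count -/

/-- The signature of the torus link `T_{q,n}` as a lattice point count, see
`signature_torusLink`. -/
def torusSignature (q n : ℕ) : ℤ := ((q : ℤ) - 1) * (n - 1) - 2 * cornerCount q n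

theorem torusSignature_comm (q n : ℕ) : torusSignature q n = torusSignature n q := by
  rw [torusSignature, torusSignature, cornerCount_comm]; ring

theorem torusSignature_add_two_mul {q n : ℕ} (hn : 0 < n) :
    torusSignature q (n + 2 * q) =
      torusSignature q n + (if Odd q then (q : ℤ) ^ 2 - 1 else (q : ℤ) ^ 2) := by
  have h := sum_range_sub_two_mul q
  rw [torusSignature, torusSignature, cornerCount_add_two_mul hn]
  push_cast
  split_ifs at h ⊢ <;> linarith

theorem torusSignature_two_mul {q : ℕ} (hq : 0 < q) :
    torusSignature q (2 * q) = (q : ℤ) ^ 2 - 1 := by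
  have h := sum_range_sub_two_mul q
  have h' := sum_range_sub_two_mul_sub_one q hq
  rw [torusSignature, cornerCount_two_mul, Finset.sum_add_distrib]
  push_cast
  split_ifs at h h' <;> linarith

theorem torusSignature_add_torusSignature {q n m : ℕ} (hn : 0 < n) (hm : 0 < m)
    (h : n + m = 2 * q) :
    torusSignature q n + torusSignature q m =
      if Odd q then (q : ℤ) ^ 2 - 1 else (q : ℤ) ^ 2 - 2 := by
  have h' := sum_range_sub_two_mul_sub_one q (by omega)
  have hc := cornerCount_add_cornerCount hn hm h
  have h'' : (n : ℤ) + m = 2 * q := by exact_mod_cast h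
  rw [torusSignature, torusSignature]
  have hc' : (cornerCount q n : ℤ) + cornerCount q m =
      2 * ∑ i ∈ Finset.range (q - 1), ((q - 2 * (i + 1) - 1 : ℕ) : ℤ) := by exact_mod_cast hc
  have hm' : (m : ℤ) = 2 * q - n := by linarith
  rw [hm']
  split_ifs at h' ⊢ <;> linarith

/-- The bounds, doubled, by induction on `q + n`. The pair `(q, n)` is reduced to `(2q - n, q)` if
`q < n < 2q`, to `(n - 2q, q)` if `2q < n < 3q`, and to `(q, n - 2q)` if `3q ≤ n`; the cases `n = q`
and `n = 2q` are explicit. -/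
theorem torusSignature_bounds (q n : ℕ) (hq : 1 ≤ q) (hqn : q ≤ n) :
    ((q : ℤ) - 1) * n ≤ 2 * torusSignature q n ∧
      2 * torusSignature q n ≤ q * (n + 1) - (if Odd q then 2 else 4)
        - (if Odd q ∧ Even n then 1 else 0) := by
  induction hN : q + n using Nat.strong_induction_on generalizing q n with
  | _ N ih =>
  subst hN
  have hq0 : (1 : ℤ) ≤ q := by exact_mod_cast hq
  have hqn0 : (q : ℤ) ≤ n := by exact_mod_cast hqn
  rcases hqn.eq_or_lt with rfl | hlt
  -- For `n = q` the reflection maps the pair to itself and determines the value.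
  · have h := torusSignature_add_torusSignature (q := q) hq hq (by ring)
    have : Odd q ∨ Even q ∧ (2 : ℤ) ≤ q := by
      rcases Nat.even_or_odd q with he | ho
      · right; refine ⟨he, ?_⟩; obtain ⟨k, rfl⟩ := he; push_cast; omega
      · left; exact ho
    rcases this with ho | ⟨he, h2⟩
    · have : ¬ Even q := by simpa using ho
      simp only [ho, this, if_true, and_false, if_false] at h ⊢
      constructor <;> nlinarith
    · have : ¬ Odd q := by simpa using he
      simp only [this, false_and, if_false] at h ⊢
      constructor <;> nlinarith
  rcases lt_trichotomy n (2 * q) with h2 | rfl | h2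
  · obtain ⟨m, hm⟩ : ∃ m, n + m = 2 * q := ⟨2 * q - n, by omega⟩
    have h := torusSignature_add_torusSignature (q := q) (n := n) (m := m) (by omega) (by omega) hm
    obtain ⟨i1, i2⟩ := ih (m + q) (by omega) m q (by omega) (by omega) rfl
    rw [torusSignature_comm m q] at i1 i2
    have hm' : (m : ℤ) = 2 * q - n := by omega
    have hlt' : (q : ℤ) + 1 ≤ n := by exact_mod_cast hlt
    have hpar : Odd m ↔ Odd n := by grind
    simp only [hpar] at i1 i2
    -- The correction for odd `q` and even `n` comes from integrality: the lower bound for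
    -- `(m, q)` is then an odd integer, below the even integer `2 σ(q, m)`.
    have key : Odd q → Even n → ((m : ℤ) - 1) * q + 1 ≤ 2 * torusSignature q m := by
      intro ho he
      have hme : Even m := by grind
      obtain ⟨a, rfl⟩ := ho
      obtain ⟨b, rfl⟩ := hme
      have : ((b + b : ℕ) - 1 : ℤ) * ((2 * a + 1 : ℕ) : ℤ)
        = 2 * (2 * a * b + b - a) - 1 := by push_cast; ring
      omega
    rw [hm'] at i1 i2 key
    rcases Nat.even_or_odd q with he | ho <;> rcases Nat.even_or_odd n with he' | ho'
    · have a1 : ¬ Odd q := by simpa using he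
      have a2 : ¬ Odd n := by simpa using he'
      simp only [a1, a2, if_false, false_and] at h i1 i2 ⊢
      constructor <;> linarith
    · have a1 : ¬ Odd q := by simpa using he
      have a2 : ¬ Even n := by simpa using ho'
      simp only [a1, ho', he, if_false, if_true, false_and, and_self] at h i1 i2 ⊢
      constructor <;> linarith
    · have a2 : ¬ Odd n := by simpa using he'
      have a1 : ¬ Even q := by simpa using ho
      have := key ho he'
      simp only [a2, ho, he', if_false, if_true, false_and, and_self] at h i1 i2 ⊢
      constructor <;> linarith
    · have a1 : ¬ Even q := by simpa using ho
      have a2 : ¬ Even n := by simpa using ho'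
      simp only [a1, a2, ho, ho', if_false, if_true, and_false] at h i1 i2 ⊢
      constructor <;> linarith
  · rw [torusSignature_two_mul hq]
    push_cast
    have h2 : Odd q ∨ (2 : ℤ) ≤ q := by
      rcases Nat.even_or_odd q with ⟨k, rfl⟩ | ho
      · right; push_cast; omega
      · left; exact ho
    split_ifs with h1 h3 h3
    · constructor <;> nlinarith
    · constructor <;> nlinarith
    · exact absurd h3.1 h1
    · have := h2.resolve_left h1
      constructor <;> nlinarith
  · obtain ⟨m, rfl⟩ : ∃ m, n = m + 2 * q := ⟨n - 2 * q, by omega⟩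
    have hm : 0 < m := by omega
    have hm0 : (1 : ℤ) ≤ m := by exact_mod_cast hm
    have hpar : Even (m + 2 * q) ↔ Even m := by grind
    simp only [torusSignature_add_two_mul hm, hpar]
    push_cast
    rcases le_or_gt q m with hqm | hqm
    · obtain ⟨i1, i2⟩ := ih (q + m) (by omega) q m hq hqm rfl
      have hqm' : (q : ℤ) ≤ m := by exact_mod_cast hqm
      split_ifs at i1 i2 ⊢ <;> constructor <;> linarith
    · obtain ⟨i1, i2⟩ := ih (m + q) (by omega) m q hm hqm.le rfl
      rw [torusSignature_comm m q] at i1 i2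
      have hqm' : (m : ℤ) + 1 ≤ q := by exact_mod_cast hqm
      rcases Nat.even_or_odd q with he | ho <;> rcases Nat.even_or_odd m with he' | ho'
      · have a1 : ¬ Odd q := by simpa using he
        have a2 : ¬ Odd m := by simpa using he'
        simp only [a1, a2, if_false, false_and] at i1 i2 ⊢
        constructor <;> linarith
      · have a1 : ¬ Odd q := by simpa using he
        simp only [a1, ho', he, if_false, if_true, false_and, and_self] at i1 i2 ⊢
        constructor <;> linarith
      · have a2 : ¬ Odd m := by simpa using he'
        simp only [a2, ho, he', if_false, if_true, false_and, and_self] at i1 i2 ⊢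
        constructor <;> linarith
      · have a1 : ¬ Even q := by simpa using ho
        have a2 : ¬ Even m := by simpa using ho'
        simp only [a1, a2, ho, ho', if_false, if_true, and_false] at i1 i2 ⊢
        constructor <;> linarith

/-! ### The symmetrised Seifert form in layers -/

/-- The coefficient of the chain `x` at the letter with generator index `e` in the `k`-th of the `n`
factors `σ₁ ⋯ σ_{q-1}`. Extended by `0` outside `k < n`, `e < q - 1`, which makes the layer above
the last one vanish. -/
def layer (q n : ℕ) (x : Fin (n * (q - 1)) → ℝ) (e k : ℕ) : ℝ :=
  if h : k < n ∧ e < q - 1 then x (finProdFinEquiv (⟨k, h.1⟩, ⟨e, h.2⟩)) else 0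

theorem layer_eq_zero {q n : ℕ} (x : Fin (n * (q - 1)) → ℝ) {e : ℕ} (he : q - 1 ≤ e) (k : ℕ) :
    layer q n x e k = 0 := dif_neg fun h => absurd h.2 (by omega)

/-- The coupling of a layer `f` with the layer `g` of the generator before it: in every factor
`σ₁ ⋯ σ_{q-1}` the letter of `g` precedes that of `f`, so that the letter of `f` in the factor `k`
comes before the letter of `g` in the factor `l` exactly if `k < l`. -/
noncomputable def pairing (n : ℕ) (f g : ℕ → ℝ) : ℝ :=
  ∑ k ∈ Finset.range n, ∑ l ∈ Finset.range n, (if k < l then 1 / 2 else -1 / 2) * (f k * g l)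

/-- The part of the chain `x` on the letters with generator index `e`. -/
def genPart {q n : ℕ} (x : Fin (n * (q - 1)) → ℝ) (e : ℕ) (t : Fin (n * (q - 1))) : ℝ :=
  if (t.modNat : ℕ) = e then x t else 0

theorem sum_eq_sum_layer {q n : ℕ} (F : Fin (n * (q - 1)) → ℝ) :
    ∑ t, F t = ∑ e ∈ Finset.range (q - 1), ∑ k ∈ Finset.range n, layer q n F e k := by
  rw [← finProdFinEquiv.sum_comp, Fintype.sum_prod_type_right, Finset.sum_range]
  refine Finset.sum_congr rfl fun e _ => ?_
  rw [Finset.sum_range]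
  refine Finset.sum_congr rfl fun k _ => ?_
  rw [layer, dif_pos ⟨k.2, e.2⟩]

theorem sum_genPart {q n : ℕ} (x : Fin (n * (q - 1)) → ℝ) (e : ℕ) :
    ∑ t, genPart x e t = ∑ k ∈ Finset.range n, layer q n x e k := by
  rw [← finProdFinEquiv.sum_comp, Fintype.sum_prod_type, Finset.sum_range]
  refine Finset.sum_congr rfl fun k _ => ?_
  have h : ∀ a : Fin (q - 1), genPart x e (finProdFinEquiv (k, a))
      = if (a : ℕ) = e then x (finProdFinEquiv (k, a)) else 0 := by
    intro a
    have : (finProdFinEquiv (k, a)).modNat = a := congrArg Prod.snd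
      (finProdFinEquiv.symm_apply_apply (k, a))
    rw [genPart, this]
  simp only [h]
  by_cases he : e < q - 1
  · rw [Finset.sum_eq_single ⟨e, he⟩, if_pos rfl, layer, dif_pos ⟨k.2, he⟩]
    · intro a _ ha
      exact if_neg fun h => ha (Fin.ext h)
    · intro h; exact absurd (Finset.mem_univ _) h
  · rw [layer_eq_zero _ (by omega)]
    exact Finset.sum_eq_zero fun a _ => if_neg (by have := a.2; omega)

theorem outflow_torusLink_of_eq_zero {q n : ℕ} (x : Fin (n * (q - 1)) → ℝ) (d : Fin q)
    (hd : (d : ℕ) = 0) : (torusLink q n).outflow x d = genPart x 0 := by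
  funext (t : Fin (n * (q - 1)))
  change (if (t.modNat : ℕ) = d then x t else 0) - (if (t.modNat : ℕ) + 1 = d then x t else 0) = _
  rw [if_neg (c := (t.modNat : ℕ) + 1 = d) (by omega), sub_zero, hd]
  rfl

theorem outflow_torusLink_of_eq_succ {q n : ℕ} (x : Fin (n * (q - 1)) → ℝ) (d : Fin q) {e : ℕ}
    (hd : (d : ℕ) = e + 1) :
    (torusLink q n).outflow x d = genPart x (e + 1) + (-1 : ℝ) • genPart x e := by
  funext (t : Fin (n * (q - 1)))
  change (if (t.modNat : ℕ) = d then x t else 0) - (if (t.modNat : ℕ) + 1 = d then x t else 0)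
    = (if (t.modNat : ℕ) = e + 1 then x t else 0) + (-1) * (if (t.modNat : ℕ) = e then x t else 0)
  simp only [hd, Nat.add_right_cancel_iff]
  ring

theorem crossingNumber_eq {N : ℕ} (f g : Fin N → ℝ) :
    BraidWord.crossingNumber f g =
      ∑ t, ∑ s, (if t < s then 1 / 2 else if s < t then -1 / 2 else 0) * (f t * g s) := by
  have h : ∀ t s : Fin N, (if t < s then (1 / 2 : ℝ) else if s < t then -1 / 2 else 0) * (f t * g s)
      = (if t < s then f t * g s / 2 else 0) - (if s < t then f t * g s / 2 else 0) := by
    intro t s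
    rcases lt_trichotomy t s with h | h | h
    · simp [h, h.not_gt]; ring
    · simp [h]
    · simp [h, h.not_gt]; ring
  simp only [h, Finset.sum_sub_distrib]
  rw [Finset.sum_comm (f := fun t s : Fin N => if s < t then f t * g s / 2 else 0)]
  simp only [← Finset.sum_sub_distrib, BraidWord.crossingNumber]
  refine Finset.sum_congr rfl fun t _ => Finset.sum_congr rfl fun s _ => ?_
  split_ifs <;> ring

theorem crossingNumber_comm {N : ℕ} (f g : Fin N → ℝ) :
    BraidWord.crossingNumber f g = - BraidWord.crossingNumber g f := by
  simp only [BraidWord.crossingNumber, ← Finset.sum_neg_distrib]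
  refine Finset.sum_congr rfl fun t _ => Finset.sum_congr rfl fun s _ => ?_
  split_ifs <;> ring

theorem sum_sum_modNat_eq {q n : ℕ} (φ : Fin (n * (q - 1)) → Fin (n * (q - 1)) → ℝ) (e e' : ℕ)
    (he : e < q - 1) (he' : e' < q - 1) :
    ∑ t, ∑ s, (if (t.modNat : ℕ) = e ∧ (s.modNat : ℕ) = e' then φ t s else 0) =
      ∑ k : Fin n, ∑ l : Fin n, φ (finProdFinEquiv (k, ⟨e, he⟩)) (finProdFinEquiv (l, ⟨e', he'⟩)) := by
  have hmod : ∀ (k : Fin n) (a : Fin (q - 1)), (finProdFinEquiv (k, a)).modNat = a := fun k a =>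
    congrArg Prod.snd (finProdFinEquiv.symm_apply_apply (k, a))
  have key : ∀ (c : ℕ) (hc : c < q - 1) (F : Fin (n * (q - 1)) → ℝ),
      ∑ t, (if (t.modNat : ℕ) = c then F t else 0) = ∑ k : Fin n, F (finProdFinEquiv (k, ⟨c, hc⟩)) := by
    intro c hc F
    rw [← finProdFinEquiv.sum_comp, Fintype.sum_prod_type]
    refine Finset.sum_congr rfl fun k _ => ?_
    rw [Finset.sum_eq_single ⟨c, hc⟩]
    · rw [hmod, if_pos rfl]
    · intro a _ ha
      rw [hmod]
      exact if_neg fun h => ha (Fin.ext h)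
    · intro h; exact absurd (Finset.mem_univ _) h
  rw [← key e he fun t => ∑ l : Fin n, φ t (finProdFinEquiv (l, ⟨e', he'⟩))]
  refine Finset.sum_congr rfl fun t _ => ?_
  split_ifs with h
  · rw [← key e' he']
    exact Finset.sum_congr rfl fun s _ => if_congr (by rw [and_iff_right h]) rfl rfl
  · exact Finset.sum_eq_zero fun s _ => if_neg fun h' => h h'.1

theorem crossingNumber_genPart_succ {q n : ℕ} (x y : Fin (n * (q - 1)) → ℝ) (e : ℕ) :
    BraidWord.crossingNumber (genPart x (e + 1)) (genPart y e)
      = pairing n (layer q n x (e + 1)) (layer q n y e) := by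
  by_cases he : e + 1 < q - 1
  · have he' : e < q - 1 := by omega
    have h : ∀ t s : Fin (n * (q - 1)),
        (if t < s then (1 / 2 : ℝ) else if s < t then -1 / 2 else 0)
          * (genPart x (e + 1) t * genPart y e s)
        = if (t.modNat : ℕ) = e + 1 ∧ (s.modNat : ℕ) = e then
          (if t < s then (1 / 2 : ℝ) else if s < t then -1 / 2 else 0) * (x t * y s) else 0 := by
      intro t s
      rw [genPart, genPart]
      by_cases h1 : (t.modNat : ℕ) = e + 1 <;> by_cases h2 : (s.modNat : ℕ) = e <;>
        simp only [h1, h2, and_self, and_true, and_false, if_true, if_false, zero_mul,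
          mul_zero]
    rw [crossingNumber_eq]
    simp only [h]
    rw [sum_sum_modNat_eq _ _ _ he he', pairing, Finset.sum_range]
    refine Finset.sum_congr rfl fun k _ => ?_
    rw [Finset.sum_range]
    refine Finset.sum_congr rfl fun l _ => ?_
    rw [layer, layer, dif_pos ⟨k.2, he⟩, dif_pos ⟨l.2, he'⟩]
    congr 1
    simp only [Fin.lt_def, finProdFinEquiv_apply_val]
    rcases lt_or_ge k l with hkl | hkl
    · have h1 : (k : ℕ) + 1 ≤ l := hkl
      have h2 : (q - 1) * (k + 1 : ℕ) ≤ (q - 1) * l := Nat.mul_le_mul_left _ h1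
      rw [mul_add] at h2
      rw [if_pos (by omega), if_pos (by exact hkl)]
    · have h1 : (l : ℕ) ≤ k := hkl
      have h2 : (q - 1) * (l : ℕ) ≤ (q - 1) * k := Nat.mul_le_mul_left _ h1
      rw [if_neg (by omega), if_pos (by omega), if_neg (by omega)]
  · have h : genPart x (e + 1) = 0 := by
      funext t
      exact if_neg (by have := t.modNat.2; omega)
    rw [h]
    simp [BraidWord.crossingNumber, pairing, layer_eq_zero x (show q - 1 ≤ e + 1 by omega)]

/-- The flows in the discs up to `D_e` telescope: each band between two of these discs cancels, and
the bands from `D_e` to `D_{e+1}` remain. -/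
theorem sum_crossingNumber_outflow {q n : ℕ} (f : Fin (n * (q - 1)) → ℝ)
    (x : Fin (n * (q - 1)) → ℝ) (e : Fin q) :
    ∑ d : Fin q, (if d ≤ e then
        BraidWord.crossingNumber f ((torusLink q n).outflow x d) else 0)
      = BraidWord.crossingNumber f (genPart x e) := by
  let o : ℕ → ℝ := fun d => if h : d < q then
    BraidWord.crossingNumber f ((torusLink q n).outflow x ⟨d, h⟩) else 0
  have h1 : ∀ d : Fin q, (if d ≤ e then
        BraidWord.crossingNumber f ((torusLink q n).outflow x d) else 0)
      = (fun d : ℕ => if d ≤ e then o d else 0) d := by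
    intro d
    simp only [o, d.2, dif_pos]
    rfl
  rw [Finset.sum_congr rfl fun d _ => h1 d,
    Fin.sum_univ_eq_sum_range (fun d : ℕ => if d ≤ e then o d else 0), ← Finset.sum_filter]
  have h2 : (Finset.range q).filter (fun d => d ≤ (e : ℕ)) = Finset.range (e + 1) := by
    ext d
    have := e.2
    simp only [Finset.mem_filter, Finset.mem_range]
    omega
  rw [h2]
  have h3 : ∀ m : ℕ, m < q →
      ∑ d ∈ Finset.range (m + 1), o d = BraidWord.crossingNumber f (genPart x m) := by
    intro m
    induction m with
    | zero =>
      intro hm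
      rw [Finset.sum_range_one]
      simp only [o, hm, dif_pos]
      rw [outflow_torusLink_of_eq_zero x _ rfl]
    | succ m ih =>
      intro hm
      rw [Finset.sum_range_succ, ih (by omega)]
      simp only [o, hm, dif_pos]
      have := BraidWord.crossingNumber_add_right f (genPart x (m + 1)) ((-1 : ℝ) • genPart x m)
      rw [BraidWord.crossingNumber_smul_right] at this
      rw [outflow_torusLink_of_eq_succ x _ rfl]
      refine (congrArg _ this).trans ?_
      ring
  exact h3 e e.2

theorem linkingNumber_eq_sum_genPart {q n : ℕ} (x y : Fin (n * (q - 1)) → ℝ) :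
    (torusLink q n).linkingNumber x y =
      ∑ e ∈ Finset.range q, BraidWord.crossingNumber (genPart y e) (genPart x e)
      + ∑ e ∈ Finset.range (q - 1), BraidWord.crossingNumber (genPart x (e + 1)) (genPart y e)
      - (∑ t, x t * y t) / 2 := by
  have hs : ∑ t, (((torusLink q n).sign t : ℤ) : ℝ) / 2 * (x t * y t)
      = (∑ t, x t * y t) / 2 := by
    rw [Finset.sum_div]
    refine Finset.sum_congr rfl fun t _ => ?_
    change (((1 : ℤˣ) : ℤ) : ℝ) / 2 * (x t * y t) = _
    simp only [Units.val_one, Int.cast_one]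
    ring
  have hl : (torusLink q n).linkingNumber x y = (∑ d : Fin q, ∑ e : Fin q, if d ≤ e then
      BraidWord.crossingNumber ((torusLink q n).outflow y e) ((torusLink q n).outflow x d) else 0)
      - ∑ t, (((torusLink q n).sign t : ℤ) : ℝ) / 2 * (x t * y t) := rfl
  rw [hl, hs, sub_left_inj, Finset.sum_comm]
  refine (Finset.sum_congr rfl fun e _ =>
    sum_crossingNumber_outflow ((torusLink q n).outflow y e) x e).trans ?_
  rcases q with _ | q
  · simp
  have hr : ∑ e ∈ Finset.range (q + 1 - 1),
      BraidWord.crossingNumber (genPart x (e + 1)) (genPart y e) =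
      ∑ e : Fin q, BraidWord.crossingNumber (genPart x (e + 1)) (genPart y e) :=
    Finset.sum_range (n := q) _
  rw [hr, Fin.sum_univ_succ, Finset.sum_range_succ', Finset.sum_range, add_right_comm,
    ← Finset.sum_add_distrib, add_comm]
  congr 1
  · refine Finset.sum_congr rfl fun e _ => ?_
    rw [outflow_torusLink_of_eq_succ y e.succ rfl]
    have := BraidWord.crossingNumber_add_left (genPart y (e + 1)) ((-1 : ℝ) • genPart y e)
      (genPart x (e + 1))
    rw [BraidWord.crossingNumber_smul_left, crossingNumber_comm (genPart y e)] at this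
    refine this.trans ?_
    ring
  · rw [outflow_torusLink_of_eq_zero y 0 rfl]
    rfl

/-- The symmetrised linking form. The self-crossings within the letters of one generator are
antisymmetric and cancel, and consecutive generators remain. -/
theorem linkingNumber_add_linkingNumber {q n : ℕ} (x y : Fin (n * (q - 1)) → ℝ) :
    (torusLink q n).linkingNumber x y + (torusLink q n).linkingNumber y x =
      ∑ e ∈ Finset.range (q - 1), (pairing n (layer q n x (e + 1)) (layer q n y e)
        + pairing n (layer q n y (e + 1)) (layer q n x e)) - ∑ t, x t * y t := by
  rw [linkingNumber_eq_sum_genPart, linkingNumber_eq_sum_genPart y x]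
  simp only [← crossingNumber_genPart_succ, Finset.sum_add_distrib, mul_comm (y _) (x _)]
  have h : ∑ e ∈ Finset.range q, BraidWord.crossingNumber (genPart y e) (genPart x e)
      = - ∑ e ∈ Finset.range q, BraidWord.crossingNumber (genPart x e) (genPart y e) := by
    rw [← Finset.sum_neg_distrib]
    exact Finset.sum_congr rfl fun e _ => crossingNumber_comm _ _
  rw [h]; ring

theorem mem_homology_torusLink_iff {q n : ℕ} (x : Fin (n * (q - 1)) → ℝ) :
    x ∈ (torusLink q n).homology ↔
      ∀ e, ∑ k ∈ Finset.range n, layer q n x e k = 0 := by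
  have key : ∀ d : Fin q, ∑ t, (torusLink q n).outflow x d t =
      ∑ k ∈ Finset.range n, layer q n x d k -
        (if (d : ℕ) = 0 then 0 else ∑ k ∈ Finset.range n, layer q n x (d - 1) k) := by
    intro d
    obtain hd | ⟨e, hd⟩ : (d : ℕ) = 0 ∨ ∃ e, (d : ℕ) = e + 1 := by
      rcases h : (d : ℕ) with _ | e
      · exact Or.inl rfl
      · exact Or.inr ⟨e, rfl⟩
    · rw [outflow_torusLink_of_eq_zero x d hd, if_pos hd, sub_zero, hd]
      exact sum_genPart x 0
    · rw [outflow_torusLink_of_eq_succ x d hd, if_neg (by omega), hd, Nat.add_sub_cancel,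
        ← sum_genPart, ← sum_genPart, sub_eq_add_neg, ← Finset.sum_neg_distrib,
        ← Finset.sum_add_distrib]
      refine Finset.sum_congr rfl fun (t : Fin (n * (q - 1))) _ => ?_
      change genPart x (e + 1) t + (-1) * genPart x e t = _
      rw [neg_one_mul]
  change (∀ d : Fin q, ∑ t, (torusLink q n).outflow x d t = 0) ↔ _
  simp only [key]
  constructor
  · intro h e
    induction e with
    | zero =>
      rcases Nat.eq_zero_or_pos q with rfl | hq
      · exact Finset.sum_eq_zero fun k _ => layer_eq_zero x (by omega) k
      · simpa using h ⟨0, hq⟩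
    | succ e ih =>
      by_cases he : e + 1 < q
      · simpa [ih] using h ⟨e + 1, he⟩
      · exact Finset.sum_eq_zero fun k _ => layer_eq_zero x (by omega) k
  · intro h d
    simp [h]

/-! ### Waves on a cycle -/

section

open Real

/-- The real wave `cos + sin` of frequency `j` on `ℤ/n`, with phase shift `α`. For `α = 0` and
varying `j` these are the Hartley basis, a real form of the Fourier basis. -/
noncomputable def wave (n : ℕ) (j : ℤ) (α : ℝ) (k : ℕ) : ℝ :=
  cos (2 * (π * j / n) * k + α) + sin (2 * (π * j / n) * k + α)

/-- The difference of the phases of an eigenchain on consecutive layers: that of `exp (2iδ) - 1`,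
where `δ = π j / n`. -/
noncomputable def phase (n : ℕ) (j : ℤ) : ℝ := π * j / n + π / 2

/-- Discrete differentiation shifts the phase of a wave and scales it by `2 sin (π j / n)`. -/
theorem wave_succ_sub_wave (n : ℕ) (j : ℤ) (α : ℝ) (k : ℕ) :
    wave n j α (k + 1) - wave n j α k =
      2 * sin (π * j / n) * wave n j (α + phase n j) k := by
  rw [wave, wave, wave, phase]
  push_cast
  generalize π * j / n = δ
  obtain ⟨θ, hθ⟩ : ∃ θ, θ = 2 * δ * k + α + δ := ⟨_, rfl⟩
  rw [show 2 * δ * (k + 1 : ℝ) + α = θ + δ by rw [hθ]; ring,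
    show 2 * δ * (k : ℝ) + α = θ - δ by rw [hθ]; ring,
    show 2 * δ * (k : ℝ) + (α + (δ + π / 2)) = θ + π / 2 by rw [hθ]; ring,
    cos_add_pi_div_two, sin_add_pi_div_two, cos_add, cos_sub, sin_add, sin_sub]
  ring

theorem wave_self {n : ℕ} (hn : 0 < n) (j : ℤ) (α : ℝ) : wave n j α n = wave n j α 0 := by
  have hn' : (n : ℝ) ≠ 0 := by positivity
  rw [wave, wave, show 2 * (π * j / n) * (n : ℝ) + α = α + j * (2 * π) by field_simp; ring,
    cos_add_int_mul_two_pi, sin_add_int_mul_two_pi]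
  simp

theorem wave_sub_phase_succ (n : ℕ) (j : ℤ) (α : ℝ) (k : ℕ) :
    wave n j (α - phase n j) (k + 1) = - wave n j (α + phase n j) k := by
  rw [wave, wave, phase]
  push_cast
  rw [show 2 * (π * j / n) * (k : ℝ) + (α + (π * j / n + π / 2))
      = (2 * (π * j / n) * (k + 1 : ℝ) + (α - (π * j / n + π / 2))) + π by ring,
    cos_add_pi, sin_add_pi]
  ring

theorem sum_wave {n : ℕ} (hn : 0 < n) {j : ℤ} (hj : sin (π * j / n) ≠ 0) (α : ℝ) :
    ∑ k ∈ Finset.range n, wave n j α k = 0 := by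
  have h := Finset.sum_range_sub (wave n j (α - phase n j)) n
  simp only [wave_succ_sub_wave, wave_self hn, sub_self, sub_add_cancel, ← Finset.mul_sum] at h
  simpa [hj] using h

theorem sin_pi_mul_div_ne_zero {n : ℕ} {j : ℤ} (h0 : j ≠ 0) (h2 : j < 2 * n) (h1 : -n < j)
    (hn : j ≠ n) : sin (π * j / n) ≠ 0 := by
  intro h
  obtain ⟨m, hm⟩ := sin_eq_zero_iff.1 h
  have hn0 : (n : ℝ) ≠ 0 := by
    rintro h'
    have : (n : ℕ) = 0 := by exact_mod_cast h'
    subst this; omega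
  rw [eq_div_iff hn0] at hm
  have hm' : (m : ℝ) * n = j := by
    have := pi_pos.ne'
    apply mul_left_cancel₀ this
    linarith
  have hm'' : m * n = j := by exact_mod_cast hm'
  have hnp : (0 : ℤ) < n := by omega
  have : m < 2 := by
    by_contra hc; push Not at hc; nlinarith
  have : -1 < m := by
    by_contra hc; push Not at hc; nlinarith
  obtain rfl | rfl : m = 0 ∨ m = 1 := by omega
  · simp at hm''; omega
  · simp at hm''; omega

theorem sum_cos_eq_zero {n : ℕ} (hn : 0 < n) {j : ℤ} (hj : sin (π * j / n) ≠ 0) (α : ℝ) :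
    ∑ k ∈ Finset.range n, cos (2 * (π * j / n) * k + α) = 0 := by
  have h1 := sum_wave hn hj α
  have h2 := sum_wave hn hj (α + π / 2)
  simp only [wave, ← add_assoc, cos_add_pi_div_two, sin_add_pi_div_two,
    Finset.sum_add_distrib, Finset.sum_neg_distrib] at h1 h2
  linarith

theorem sum_sin_eq_zero {n : ℕ} (hn : 0 < n) {j : ℤ} (hj : sin (π * j / n) ≠ 0) (α : ℝ) :
    ∑ k ∈ Finset.range n, sin (2 * (π * j / n) * k + α) = 0 := by
  have h1 := sum_wave hn hj α
  have h2 := sum_wave hn hj (α + π / 2)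
  simp only [wave, ← add_assoc, cos_add_pi_div_two, sin_add_pi_div_two,
    Finset.sum_add_distrib, Finset.sum_neg_distrib] at h1 h2
  linarith

/-- Waves of different frequencies are orthogonal in every layer. For `j + j' = n` this needs the
phases: they add up to `2 π`, hence the waves are those of opposite frequencies and phases. -/
theorem sum_wave_mul_wave {n : ℕ} {j j' : ℤ} (hj : 0 < j) (hjn : j < n) (hj' : 0 < j')
    (hjn' : j' < n) (hne : j ≠ j') (e : ℕ) :
    ∑ k ∈ Finset.range n, wave n j (e * phase n j) k * wave n j' (e * phase n j') k = 0 := by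
  have hn : 0 < n := by omega
  have hn' : (n : ℝ) ≠ 0 := by positivity
  -- The differences have frequency `j - j'` and the sums `j + j'`. Both are nonzero modulo `n`, unless
  -- `j + j' = n`.
  have hmul : ∀ A B : ℝ, (cos A + sin A) * (cos B + sin B) = cos (A - B) + sin (A + B) := by
    intro A B; rw [cos_sub, sin_add]; ring
  simp only [wave, hmul, Finset.sum_add_distrib]
  have h1 := sum_cos_eq_zero hn (j := j - j')
    (sin_pi_mul_div_ne_zero (by omega) (by omega) (by omega) (by omega))
    (e * phase n j - e * phase n j')
  have e1 : ∀ k : ℕ, 2 * (π * j / n) * (k : ℝ) + e * phase n j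
      - (2 * (π * j' / n) * k + e * phase n j')
      = 2 * (π * (j - j' : ℤ) / n) * k + (e * phase n j - e * phase n j') := by
    intro k; push_cast; ring
  have e2 : ∀ k : ℕ, 2 * (π * j / n) * (k : ℝ) + e * phase n j
      + (2 * (π * j' / n) * k + e * phase n j')
      = 2 * (π * (j + j' : ℤ) / n) * k + (e * phase n j + e * phase n j') := by
    intro k; push_cast; ring
  simp only [e1, e2, h1, zero_add]
  by_cases hs : j + j' = n
  · refine Finset.sum_eq_zero fun k _ => ?_
    have hp : phase n j + phase n j' = 2 * π := by
      have : (j : ℝ) + j' = n := by exact_mod_cast hs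
      rw [phase, phase, show π * j / n + π / 2 + (π * j' / n + π / 2) = π * ((j + j') / n) + π by ring,
        this, div_self hn']
      ring
    rw [← mul_add, hp, hs, Int.cast_natCast, mul_div_assoc, div_self hn',
      show 2 * (π * 1) * (k : ℝ) + e * (2 * π) = ((2 * (k + e) : ℕ) : ℝ) * π by push_cast; ring,
      sin_nat_mul_pi]
  · exact sum_sin_eq_zero hn
      (sin_pi_mul_div_ne_zero (by omega) (by omega) (by omega) hs) _

/-! ### Eigenchains -/

/-- Summation of a difference `G (k + 1) - G k` against a step function. -/
theorem sum_half_mul_sub (G : ℕ → ℝ) (l m : ℕ) :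
    ∑ k ∈ Finset.range m, (if k < l then (1 / 2 : ℝ) else -1 / 2) * (G (k + 1) - G k)
      = if m ≤ l then (G m - G 0) / 2 else G l - (G m + G 0) / 2 := by
  induction m with
  | zero => simp
  | succ m ih =>
    rw [Finset.sum_range_succ, ih]
    rcases lt_trichotomy m l with h | rfl | h
    · rw [if_pos h.le, if_pos h, if_pos (by omega)]; ring
    · rw [if_pos le_rfl, if_neg (by omega), if_neg (by omega)]; ring
    · rw [if_neg (by omega), if_neg (by omega), if_neg (by omega)]; ring

/-- If `r • f` is the difference of the periodic function `G`, then pairing `f` with a layer that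
sums to zero amounts to integrating that layer against `G`. -/
theorem mul_pairing_of_left {n : ℕ} {r : ℝ} {f G g : ℕ → ℝ}
    (hf : ∀ k < n, r * f k = G (k + 1) - G k) (hG : G n = G 0)
    (hg : ∑ k ∈ Finset.range n, g k = 0) :
    r * pairing n f g = ∑ l ∈ Finset.range n, G l * g l := by
  have h : r * pairing n f g = ∑ l ∈ Finset.range n, (G l - G 0) * g l := by
    rw [pairing, Finset.sum_comm, Finset.mul_sum]
    refine Finset.sum_congr rfl fun l hl => ?_
    have hl' := Finset.mem_range.1 hl
    have := sum_half_mul_sub G l n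
    rw [if_neg (by omega), hG] at this
    rw [show G l - G 0 = G l - (G 0 + G 0) / 2 by ring, ← this, Finset.mul_sum, Finset.sum_mul]
    refine Finset.sum_congr rfl fun k hk => ?_
    rw [← hf k (Finset.mem_range.1 hk)]
    ring
  rw [h]
  simp only [sub_mul, Finset.sum_sub_distrib, ← Finset.mul_sum, hg, mul_zero, sub_zero]

theorem mul_pairing_of_right {n : ℕ} {r : ℝ} {f G g : ℕ → ℝ}
    (hf : ∀ k < n, r * f k = G (k + 1) - G k) (hG : G n = G 0)
    (hg : ∑ k ∈ Finset.range n, g k = 0) :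
    r * pairing n g f = - ∑ k ∈ Finset.range n, G (k + 1) * g k := by
  have h : r * pairing n g f = ∑ k ∈ Finset.range n, (G 0 - G (k + 1)) * g k := by
    rw [pairing, Finset.mul_sum]
    refine Finset.sum_congr rfl fun k hk => ?_
    have hk' := Finset.mem_range.1 hk
    have := sum_half_mul_sub G (k + 1) n
    have h' : ∑ l ∈ Finset.range n, (if l < k + 1 then (1 / 2 : ℝ) else -1 / 2) * (G (l + 1) - G l)
        = G (k + 1) - G 0 := by
      rw [this, hG]
      split_ifs with hnk
      · rw [show k + 1 = n by omega, hG]; ring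
      · ring
    rw [← neg_sub, ← h', Finset.mul_sum, neg_mul, Finset.sum_mul, ← Finset.sum_neg_distrib]
    refine Finset.sum_congr rfl fun l hl => ?_
    rw [← hf l (Finset.mem_range.1 hl)]
    rcases lt_or_ge k l with hkl | hkl
    · rw [if_pos hkl, if_neg (by omega)]; ring
    · rw [if_neg (by omega), if_pos (by omega)]; ring
  rw [h]
  simp only [sub_mul, Finset.sum_sub_distrib, ← Finset.mul_sum, hg, mul_zero, zero_sub]

/-- The chain that is, on the layer `e`, the wave of frequency `j` and phase `e * phase n j`, scaled
by `sin (π i (e + 1) / q)`. It diagonalises the symmetrised Seifert form. -/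
noncomputable def eigenchain (q n : ℕ) (i : ℕ) (j : ℤ) (t : Fin (n * (q - 1))) : ℝ :=
  sin (π * i * ((t.modNat : ℕ) + 1) / q) * wave n j ((t.modNat : ℕ) * phase n j) t.divNat

/-- The formula also holds on the layer `e = q - 1`, where both sides vanish. -/
theorem layer_eigenchain {q n i : ℕ} {j : ℤ} {e k : ℕ} (he : e ≤ q - 1) (hk : k < n)
    (hq : 0 < q) :
    layer q n (eigenchain q n i j) e k
      = sin (π * i * (e + 1) / q) * wave n j (e * phase n j) k := by
  rcases he.lt_or_eq with he | rfl
  · have h := finProdFinEquiv.symm_apply_apply ((⟨k, hk⟩, ⟨e, he⟩) : Fin n × Fin (q - 1))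
    rw [layer, dif_pos ⟨hk, he⟩, eigenchain]
    have h1 : (finProdFinEquiv ((⟨k, hk⟩, ⟨e, he⟩) : Fin n × Fin (q - 1))).modNat = ⟨e, he⟩ :=
      congrArg Prod.snd h
    have h2 : (finProdFinEquiv ((⟨k, hk⟩, ⟨e, he⟩) : Fin n × Fin (q - 1))).divNat = ⟨k, hk⟩ :=
      congrArg Prod.fst h
    rw [h1, h2]
  · have hq' : (q : ℝ) ≠ 0 := by positivity
    rw [layer_eq_zero _ le_rfl, Nat.cast_sub hq, Nat.cast_one, sub_add_cancel,
      mul_div_assoc, div_self hq', mul_one, mul_comm π, sin_nat_mul_pi, zero_mul]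

theorem sum_layer_eigenchain {q n i : ℕ} {j : ℤ} (hn : 0 < n) (hj : sin (π * j / n) ≠ 0) (e : ℕ) :
    ∑ k ∈ Finset.range n, layer q n (eigenchain q n i j) e k = 0 := by
  rcases lt_or_ge e (q - 1) with he | he
  · rw [Finset.sum_congr rfl fun k hk => layer_eigenchain he.le (Finset.mem_range.1 hk) (by omega),
      ← Finset.mul_sum, sum_wave hn hj, mul_zero]
  · exact Finset.sum_eq_zero fun k _ => layer_eq_zero _ he k

theorem layer_mul {q n : ℕ} (x y : Fin (n * (q - 1)) → ℝ) (e k : ℕ) :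
    layer q n (fun t => x t * y t) e k = layer q n x e k * layer q n y e k := by
  rw [layer, layer, layer]
  split_ifs <;> simp

/-- The coupling maps a wave to the waves on the two neighbouring layers, with the phases of the
eigenchain there. What remains is the path graph on `q - 1` vertices, with eigenvectors
`sin (π i (e + 1) / q)` and eigenvalues `2 cos (π i / q)`. -/
theorem mul_sum_pairing_eigenchain {q n i : ℕ} {j : ℤ} (hq : 0 < q) (hn : 0 < n)
    (y : Fin (n * (q - 1)) → ℝ)
    (hy : ∀ e, ∑ k ∈ Finset.range n, layer q n y e k = 0) :
    2 * sin (π * j / n) * ∑ e ∈ Finset.range (q - 1),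
      (pairing n (layer q n (eigenchain q n i j) (e + 1)) (layer q n y e)
        + pairing n (layer q n y (e + 1)) (layer q n (eigenchain q n i j) e))
      = 2 * cos (π * i / q) * ∑ t, eigenchain q n i j t * y t := by
  set s : ℕ → ℝ := fun e => sin (π * i * e / q) with hs
  set a : ℕ → ℝ := fun e => ∑ k ∈ Finset.range n, wave n j (e * phase n j) k * layer q n y e k
    with ha
  have hcast : ∀ e : ℕ, ((e + 1 : ℕ) : ℝ) * phase n j = e * phase n j + phase n j := by
    intro e; push_cast; ring
  have h1 : ∀ e < q - 1, 2 * sin (π * j / n) *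
      pairing n (layer q n (eigenchain q n i j) (e + 1)) (layer q n y e) = s (e + 2) * a e := by
    intro e he
    rw [mul_pairing_of_left (G := fun k => s (e + 2) * wave n j (e * phase n j) k) _ _ (hy e)]
    · rw [ha, Finset.mul_sum]
      exact Finset.sum_congr rfl fun k _ => mul_assoc _ _ _
    · intro k hk
      rw [layer_eigenchain (by omega) hk hq, ← mul_sub, wave_succ_sub_wave, hcast, hs]
      push_cast
      rw [add_assoc (e : ℝ) 1 1, one_add_one_eq_two]
      ring
    · simp only [wave_self hn]
  have h2 : ∀ e < q - 1, 2 * sin (π * j / n) *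
      pairing n (layer q n y (e + 1)) (layer q n (eigenchain q n i j) e)
        = s (e + 1) * a (e + 1) := by
    intro e he
    rw [mul_pairing_of_right
      (G := fun k => s (e + 1) * wave n j (e * phase n j - phase n j) k) _ _ (hy (e + 1))]
    · rw [ha, Finset.mul_sum, ← Finset.sum_neg_distrib]
      refine Finset.sum_congr rfl fun k _ => ?_
      rw [wave_sub_phase_succ, hcast]
      ring
    · intro k hk
      rw [layer_eigenchain (by omega) hk hq, ← mul_sub, wave_succ_sub_wave, sub_add_cancel, hs]
      push_cast
      ring
    · simp only [wave_self hn]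
  -- The two boundary terms vanish: `s 0 = 0`, and the layer `q - 1` of `y` is zero.
  have h3 : ∑ e ∈ Finset.range (q - 1), s (e + 1) * a (e + 1)
      = ∑ e ∈ Finset.range (q - 1), s e * a e := by
    have e1 := Finset.sum_range_succ (fun e => s e * a e) (q - 1)
    rw [Finset.sum_range_succ'] at e1
    have e2 : a (q - 1) = 0 :=
      Finset.sum_eq_zero fun k _ => by rw [layer_eq_zero y le_rfl, mul_zero]
    have e3 : s 0 = 0 := by simp [hs]
    rw [e2, e3] at e1
    linarith
  have h4 : ∑ t, eigenchain q n i j t * y t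
      = ∑ e ∈ Finset.range (q - 1), s (e + 1) * a e := by
    rw [sum_eq_sum_layer (fun t => eigenchain q n i j t * y t)]
    refine Finset.sum_congr rfl fun e he => ?_
    rw [ha, Finset.mul_sum]
    refine Finset.sum_congr rfl fun k hk => ?_
    rw [layer_mul, layer_eigenchain (Finset.mem_range.1 he).le (Finset.mem_range.1 hk) hq, hs]
    push_cast
    ring
  rw [h4, Finset.mul_sum, Finset.mul_sum]
  simp only [mul_add]
  rw [Finset.sum_add_distrib, Finset.sum_congr rfl fun e he => h1 e (Finset.mem_range.1 he),
    Finset.sum_congr rfl fun e he => h2 e (Finset.mem_range.1 he), h3, ← Finset.sum_add_distrib]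
  refine Finset.sum_congr rfl fun e _ => ?_
  have h5 : s (e + 2) + s e = 2 * cos (π * i / q) * s (e + 1) := by
    simp only [hs]
    push_cast
    rw [show π * i * (e + 2) / q = π * i * (e + 1) / q + π * i / q by ring,
      show π * i * (e : ℝ) / q = π * i * (e + 1) / q - π * i / q by ring, sin_add, sin_sub]
    ring
  rw [← add_mul, h5, mul_assoc]

theorem sum_eigenchain_mul_of_ne {q n i i' : ℕ} {j j' : ℤ} (hj : 0 < j) (hjn : j < n) (hj' : 0 < j')
    (hjn' : j' < n) (hne : j ≠ j') :
    ∑ t, eigenchain q n i j t * eigenchain q n i' j' t = 0 := by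
  rw [sum_eq_sum_layer (fun t => eigenchain q n i j t * eigenchain q n i' j' t)]
  refine Finset.sum_eq_zero fun e he => ?_
  have he' := Finset.mem_range.1 he
  have h : ∀ k ∈ Finset.range n,
      layer q n (fun t => eigenchain q n i j t * eigenchain q n i' j' t) e k =
      sin (π * i * (e + 1) / q) * sin (π * i' * (e + 1) / q) *
        (wave n j (e * phase n j) k * wave n j' (e * phase n j') k) := by
    intro k hk
    rw [layer_mul, layer_eigenchain he'.le (Finset.mem_range.1 hk) (by omega),
      layer_eigenchain he'.le (Finset.mem_range.1 hk) (by omega)]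
    ring
  rw [Finset.sum_congr rfl h, ← Finset.mul_sum, sum_wave_mul_wave hj hjn hj' hjn' hne, mul_zero]

theorem sum_eigenchain_mul_self_pos {q n i : ℕ} {j : ℤ} (hi : 0 < i) (hiq : i < q) (hn : 0 < n) :
    0 < ∑ t, eigenchain q n i j t * eigenchain q n i j t := by
  refine Finset.sum_pos' (fun t _ => mul_self_nonneg _)
    ⟨finProdFinEquiv (⟨0, hn⟩, ⟨0, by omega⟩), Finset.mem_univ _, ?_⟩
  have h := layer_eigenchain (q := q) (n := n) (i := i) (j := j) (Nat.zero_le _) hn (by omega)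
  rw [layer, dif_pos ⟨hn, by omega⟩] at h
  rw [h]
  refine mul_self_pos.2 ?_
  have h1 : 0 < sin (π * i / q) := by
    have hq : (0 : ℝ) < q := by exact_mod_cast (hi.trans hiq)
    have : (i : ℝ) < q := by exact_mod_cast hiq
    have hi' : (0 : ℝ) < i := by exact_mod_cast hi
    refine sin_pos_of_pos_of_lt_pi (by positivity) ?_
    rw [div_lt_iff₀ hq]
    exact mul_lt_mul_of_pos_left this pi_pos
  simp [wave, h1.ne']

/-! ### The signature -/

theorem sin_lt_cos_iff {q n i j : ℕ} (hi : 0 < i) (hiq : i < q) (hj : 0 < j) (hjn : j < n) :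
    (sin (π * j / n) < cos (π * i / q) ↔
      2 * (i * n + j * q) < q * n ∨ 2 * (i * n + (n - j) * q) < q * n) ∧
    (sin (π * j / n) ≤ cos (π * i / q) ↔
      2 * (i * n + j * q) ≤ q * n ∨ 2 * (i * n + (n - j) * q) ≤ q * n) := by
  have hq0 : (0 : ℝ) < q := by exact_mod_cast hi.trans hiq
  have hn0 : (0 : ℝ) < n := by exact_mod_cast hj.trans hjn
  have hi0 : (0 : ℝ) < i := by exact_mod_cast hi
  have hj0 : (0 : ℝ) < j := by exact_mod_cast hj
  have hiq' : (i : ℝ) < q := by exact_mod_cast hiq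
  have hjn' : (j : ℝ) < n := by exact_mod_cast hjn
  have hx : π * i / q ∈ Set.Icc 0 π := by
    refine ⟨by positivity, ?_⟩
    rw [div_le_iff₀ hq0]
    exact mul_le_mul_of_nonneg_left hiq'.le pi_pos.le
  have hy0 : 0 < π * j / n := by positivity
  have hy1 : π * j / n < π := by
    rw [div_lt_iff₀ hn0]
    exact mul_lt_mul_of_pos_left hjn' pi_pos
  have hy : |π / 2 - π * j / n| ∈ Set.Icc 0 π :=
    ⟨abs_nonneg _, abs_le.2 ⟨by linarith, by linarith⟩⟩
  have hsin : sin (π * j / n) = cos |π / 2 - π * j / n| := by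
    rw [cos_abs, cos_pi_div_two_sub]
  have e1 : π / 2 - π * j / n - π * i / q
      = π * (q * n - 2 * (i * n + j * q)) / (2 * q * n) := by
    field_simp; ring
  have e2 : -(π / 2 - π * j / n) - π * i / q
      = π * (q * n - 2 * (i * n + (n - j) * q)) / (2 * q * n) := by
    field_simp; ring
  have hd : 0 < 2 * (q : ℝ) * n := by positivity
  have hc1 : 2 * (i * n + j * q) < q * n ↔ (0 : ℝ) < q * n - 2 * (i * n + j * q) := by
    rw [sub_pos]; exact_mod_cast Iff.rfl
  have hc1' : 2 * (i * n + j * q) ≤ q * n ↔ (0 : ℝ) ≤ q * n - 2 * (i * n + j * q) := by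
    rw [sub_nonneg]; exact_mod_cast Iff.rfl
  have hc2 : 2 * (i * n + (n - j) * q) < q * n
      ↔ (0 : ℝ) < q * n - 2 * (i * n + (n - j) * q) := by
    rw [sub_pos, ← Nat.cast_sub hjn.le]; exact_mod_cast Iff.rfl
  have hc2' : 2 * (i * n + (n - j) * q) ≤ q * n
      ↔ (0 : ℝ) ≤ q * n - 2 * (i * n + (n - j) * q) := by
    rw [sub_nonneg, ← Nat.cast_sub hjn.le]; exact_mod_cast Iff.rfl
  rw [hsin, strictAntiOn_cos.lt_iff_gt hy hx, strictAntiOn_cos.le_iff_ge hy hx, lt_abs, le_abs,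
    ← sub_pos, ← sub_pos (a := -(π / 2 - π * j / n)), ← sub_nonneg,
    ← sub_nonneg (a := -(π / 2 - π * j / n)), e1, e2, hc1, hc2, hc1', hc2']
  simp only [lt_div_iff₀ hd, le_div_iff₀ hd, zero_mul, mul_pos_iff_of_pos_left pi_pos,
    mul_nonneg_iff_of_pos_left pi_pos, and_self]

/-- The signs of `sin (π j / n) - cos (π i / q)` sum to the lattice point count: the `(i, j)` with a
negative sign are the lattice points of two congruent triangles, exchanged by `j ↦ n - j`. -/
theorem sum_sign_eq_torusSignature {q n : ℕ} (hq : 0 < q) (hn : 0 < n) :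
    ∑ a : Fin (q - 1) × Fin (n - 1),
      ((if cos (π * (a.1 + 1 : ℕ) / q) < sin (π * (a.2 + 1 : ℕ) / n) then (1 : ℤ) else 0) -
        (if sin (π * (a.2 + 1 : ℕ) / n) < cos (π * (a.1 + 1 : ℕ) / q) then 1 else 0))
      = torusSignature q n := by
  let c : ℕ → ℕ → ℤ := fun i j =>
    (if 2 * ((i + 1) * n + (j + 1) * q) < q * n then 1 else 0) +
      (if 2 * ((i + 1) * n + (j + 1) * q) ≤ q * n then 1 else 0)
  have h : ∀ a : Fin (q - 1) × Fin (n - 1),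
      ((if cos (π * (a.1 + 1 : ℕ) / q) < sin (π * (a.2 + 1 : ℕ) / n) then (1 : ℤ) else 0) -
        (if sin (π * (a.2 + 1 : ℕ) / n) < cos (π * (a.1 + 1 : ℕ) / q) then 1 else 0))
      = 1 - (c a.1 a.2 + c a.1 (n - 1 - 1 - a.2)) := by
    rintro ⟨⟨i, hi⟩, ⟨j, hj⟩⟩
    obtain ⟨h1, h2⟩ := sin_lt_cos_iff (q := q) (n := n) (i := i + 1) (j := j + 1) (by omega)
      (by omega) (by omega) (by omega)
    -- The two closed triangles are disjoint.
    have hlt : ∀ i' j' : ℕ, 0 < i' → 0 < j' → j' < n → 2 * (i' * n + j' * q) ≤ q * n →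
        ¬ 2 * (i' * n + (n - j') * q) ≤ q * n := by
      intro i' j' hi' hj' hjn h3 h4
      have : (n - j') * q + j' * q = n * q := by rw [← add_mul]; congr 1; omega
      have := Nat.mul_pos hi' hn
      have := mul_comm n q
      omega
    have hx := hlt (i + 1) (j + 1) (by omega) (by omega) (by omega)
    simp only [c, show n - 1 - 1 - j + 1 = n - (j + 1) by omega]
    rw [if_congr (not_le.symm.trans (not_congr h2)) rfl rfl, if_congr h1 rfl rfl]
    generalize hA : 2 * ((i + 1) * n + (j + 1) * q) = A at *
    generalize hB : 2 * ((i + 1) * n + (n - (j + 1)) * q) = B at *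
    generalize q * n = C at *
    clear h1 h2 hlt
    by_cases h3 : A ≤ C <;> by_cases h4 : B ≤ C <;> by_cases h5 : A < C <;> by_cases h6 : B < C <;>
      simp_all <;> omega
  have hc : ∑ i ∈ Finset.range (q - 1), ∑ j ∈ Finset.range (n - 1), c i j = cornerCount q n := by
    rw [cornerCount]
    push_cast
    rfl
  have hc' : ∑ i ∈ Finset.range (q - 1), ∑ j ∈ Finset.range (n - 1), c i (n - 1 - 1 - j)
      = cornerCount q n := by
    rw [← hc]
    exact Finset.sum_congr rfl fun i _ => Finset.sum_range_reflect (c i) (n - 1)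
  rw [Finset.sum_congr rfl fun a _ => h a, Finset.sum_sub_distrib, Finset.sum_add_distrib,
    Fintype.sum_prod_type (f := fun a : Fin (q - 1) × Fin (n - 1) => c a.1 a.2),
    Fintype.sum_prod_type (f := fun a : Fin (q - 1) × Fin (n - 1) => c a.1 (n - 1 - 1 - a.2))]
  simp only [Finset.sum_range] at hc hc'
  rw [hc, hc', torusSignature, Finset.sum_const, Finset.card_univ, Fintype.card_prod,
    Fintype.card_fin, Fintype.card_fin, nsmul_eq_mul]
  push_cast [Nat.cast_sub hq, Nat.cast_sub hn, Nat.cast_pred hq, Nat.cast_pred hn]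
  ring

/-- Sylvester's law of inertia, for an orthogonal basis. -/
theorem sigNeg_sub_sigPos_of_basis {M ι : Type*} [AddCommGroup M] [Module ℝ M] [Fintype ι]
    (S : LinearMap.BilinForm ℝ M) (hS : ∀ x y, S x y = S y x) (v : Module.Basis ι ℝ M)
    (hv : ∀ a b, a ≠ b → S (v a) (v b) = 0) :
    (sigNeg S.toQuadraticMap : ℤ) - sigPos S.toQuadraticMap =
      ∑ a, ((if S (v a) (v a) < 0 then (1 : ℤ) else 0) - (if 0 < S (v a) (v a) then 1 else 0)) := by
  have hass : QuadraticMap.associated (R := ℝ) S.toQuadraticMap = S := by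
    rw [QuadraticMap.associated_left_inverse ℝ]
    exact hS
  have he : QuadraticMap.Equivalent S.toQuadraticMap
      (QuadraticMap.weightedSumSquares ℝ fun a => S (v a) (v a)) := by
    have h := QuadraticMap.basisRepr_eq_of_iIsOrtho S.toQuadraticMap v
      (by rw [hass]; exact fun a b hab => hv a b hab)
    refine ⟨?_⟩
    have := S.toQuadraticMap.isometryEquivBasisRepr v
    rw [h] at this
    exact this
  rw [QuadraticForm.sigNeg_of_equiv_weightedSumSquares he,
    QuadraticForm.sigPos_of_equiv_weightedSumSquares he, Finset.sum_sub_distrib]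
  simp only [Finset.sum_boole, Set.ncard_eq_toFinset_card', Set.toFinset_ofPred]

/-- The homology is the kernel of the surjection that maps a chain to the sums of its layers. -/
theorem finrank_homology_torusLink {q n : ℕ} (hn : 0 < n) :
    Module.finrank ℝ (torusLink q n).homology = (q - 1) * (n - 1) := by
  let L : (Fin (n * (q - 1)) → ℝ) →ₗ[ℝ] (Fin (q - 1) → ℝ) :=
    LinearMap.pi fun e => ∑ k : Fin n, LinearMap.proj (finProdFinEquiv (k, e))
  have hL : ∀ x e, L x e = ∑ k ∈ Finset.range n, layer q n x e k := by
    intro x e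
    rw [Finset.sum_range]
    simp only [L, LinearMap.pi_apply, LinearMap.sum_apply, LinearMap.proj_apply]
    refine Finset.sum_congr rfl fun k _ => ?_
    rw [layer, dif_pos ⟨k.2, e.2⟩]
  have hker : LinearMap.ker L = (torusLink q n).homology := by
    ext x
    rw [LinearMap.mem_ker]
    refine Iff.trans ?_ (mem_homology_torusLink_iff x).symm
    constructor
    · intro h e
      rcases lt_or_ge e (q - 1) with he | he
      · rw [← hL x ⟨e, he⟩, h]; rfl
      · exact Finset.sum_eq_zero fun k _ => layer_eq_zero _ he k
    · intro h
      funext e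
      rw [hL, h]; rfl
  have hsurj : LinearMap.range L = ⊤ := by
    rw [LinearMap.range_eq_top]
    intro z
    refine ⟨fun t => if (t.divNat : ℕ) = 0 then z t.modNat else 0, ?_⟩
    funext e
    simp only [L, LinearMap.pi_apply, LinearMap.sum_apply, LinearMap.proj_apply]
    have h : ∀ k : Fin n, (if ((finProdFinEquiv (k, e)).divNat : ℕ) = 0 then
        z (finProdFinEquiv (k, e)).modNat else 0) = if (k : ℕ) = 0 then z e else 0 := by
      intro k
      have h := finProdFinEquiv.symm_apply_apply (k, e)
      have h1 : (finProdFinEquiv (k, e)).modNat = e := congrArg Prod.snd h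
      have h2 : (finProdFinEquiv (k, e)).divNat = k := congrArg Prod.fst h
      rw [h1, h2]
    rw [Finset.sum_congr rfl fun k _ => h k, Finset.sum_eq_single ⟨0, hn⟩, if_pos rfl]
    · intro k _ hk
      exact if_neg fun h => hk (Fin.ext h)
    · intro h; exact absurd (Finset.mem_univ _) h
  have h := L.finrank_range_add_finrank_ker
  rw [hsurj, finrank_top, hker] at h
  simp only [Module.finrank_fintype_fun_eq_card, Fintype.card_fin] at h
  rw [Nat.mul_sub, mul_one, mul_comm (q - 1) n]
  exact Nat.eq_sub_of_add_eq' h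

theorem two_mul_sin_mul_linkingNumber {q n i : ℕ} {j : ℤ} (hq : 0 < q) (hn : 0 < n)
    (y : Fin (n * (q - 1)) → ℝ) (hy : y ∈ (torusLink q n).homology) :
    2 * sin (π * j / n) * ((torusLink q n).linkingNumber (eigenchain q n i j) y
        + (torusLink q n).linkingNumber y (eigenchain q n i j))
      = 2 * (cos (π * i / q) - sin (π * j / n)) * ∑ t, eigenchain q n i j t * y t := by
  rw [linkingNumber_add_linkingNumber, mul_sub,
    mul_sum_pairing_eigenchain hq hn y ((mem_homology_torusLink_iff y).1 hy)]
  ring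

theorem signature_torusLink {q n : ℕ} (hq : 0 < q) (hn : 0 < n) :
    (torusLink q n).signature = torusSignature q n := by
  set w := torusLink q n with hw
  set S : LinearMap.BilinForm ℝ w.homology := w.seifertForm + w.seifertForm.flip with hSdef
  have hS : ∀ x y, S x y = w.linkingNumber x y + w.linkingNumber y x := fun x y => rfl
  have hsymm : ∀ x y, S x y = S y x := fun x y => by rw [hS, hS, add_comm]
  have hsin : ∀ b : Fin (n - 1), 0 < sin (π * ((b + 1 : ℕ) : ℤ) / n) := by
    intro b
    have hn0 : (0 : ℝ) < n := by exact_mod_cast hn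
    have hb : ((b + 1 : ℕ) : ℝ) < n := by
      have := b.2
      exact_mod_cast (by omega : (b : ℕ) + 1 < n)
    refine sin_pos_of_pos_of_lt_pi (by push_cast; positivity) ?_
    rw [div_lt_iff₀ hn0, Int.cast_natCast]
    exact mul_lt_mul_of_pos_left hb pi_pos
  let v : Fin (q - 1) × Fin (n - 1) → w.homology := fun a =>
    ⟨eigenchain q n (a.1 + 1) ((a.2 + 1 : ℕ) : ℤ), (mem_homology_torusLink_iff _).2
      (sum_layer_eigenchain hn (hsin a.2).ne')⟩
  let ip : Fin (q - 1) × Fin (n - 1) → Fin (q - 1) × Fin (n - 1) → ℝ := fun a b =>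
    ∑ t, eigenchain q n (a.1 + 1) ((a.2 + 1 : ℕ) : ℤ) t *
      eigenchain q n (b.1 + 1) ((b.2 + 1 : ℕ) : ℤ) t
  have hSv : ∀ a b, 2 * sin (π * ((a.2 + 1 : ℕ) : ℤ) / n) * S (v a) (v b)
      = 2 * (cos (π * (a.1 + 1 : ℕ) / q) - sin (π * ((a.2 + 1 : ℕ) : ℤ) / n)) * ip a b :=
    fun a b => two_mul_sin_mul_linkingNumber hq hn _ (v b).2
  -- For equal `j` the eigenvalues are distinct, which gives orthogonality by symmetry of `S`; for
  -- distinct `j` the waves are orthogonal in every layer.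
  have hip : ∀ a b, a ≠ b → ip a b = 0 := by
    rintro ⟨a1, a2⟩ ⟨b1, b2⟩ hab
    by_cases h2 : a2 = b2
    · subst h2
      have h1 := hSv (a1, a2) (b1, a2)
      have h1' := hSv (b1, a2) (a1, a2)
      have hc : ip (b1, a2) (a1, a2) = ip (a1, a2) (b1, a2) :=
        Finset.sum_congr rfl fun t _ => mul_comm _ _
      rw [hsymm, h1', hc] at h1
      have hne : cos (π * (a1 + 1 : ℕ) / q) ≠ cos (π * (b1 + 1 : ℕ) / q) := by
        have hq0 : (0 : ℝ) < q := by exact_mod_cast hq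
        have hmem : ∀ c : Fin (q - 1), π * (c + 1 : ℕ) / q ∈ Set.Icc 0 π := by
          intro c
          have hc : ((c + 1 : ℕ) : ℝ) ≤ q := by
            have := c.2
            exact_mod_cast (by omega : (c : ℕ) + 1 ≤ q)
          refine ⟨by positivity, ?_⟩
          rw [div_le_iff₀ hq0]
          exact mul_le_mul_of_nonneg_left hc pi_pos.le
        intro hcos
        have h := injOn_cos (hmem a1) (hmem b1) hcos
        have h' : ((a1 + 1 : ℕ) : ℝ) = (b1 + 1 : ℕ) := by
          rw [div_left_inj' hq0.ne'] at h
          exact mul_left_cancel₀ pi_pos.ne' h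
        have h'' : (a1 : ℕ) + 1 = b1 + 1 := by exact_mod_cast h'
        exact hab (by rw [Fin.ext (Nat.add_right_cancel h'')])
      have h3 : (cos (π * (a1 + 1 : ℕ) / q) - cos (π * (b1 + 1 : ℕ) / q))
          * ip (a1, a2) (b1, a2) = 0 := by linarith
      exact (mul_eq_zero.1 h3).resolve_left (sub_ne_zero.2 hne)
    · have ha := a2.2
      have hb := b2.2
      have hne : (a2 : ℕ) ≠ b2 := fun h => h2 (Fin.ext h)
      exact sum_eigenchain_mul_of_ne (by positivity) (by dsimp only; omega) (by positivity)
        (by dsimp only; omega) (by dsimp only; omega)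
  have hpos : ∀ a, 0 < ip a a := fun a =>
    sum_eigenchain_mul_self_pos (by omega) (by have := a.1.2; omega) hn
  have hlin : LinearIndependent ℝ v := by
    have hv' : LinearIndependent ℝ fun a : Fin (q - 1) × Fin (n - 1) =>
        eigenchain q n (a.1 + 1) ((a.2 + 1 : ℕ) : ℤ) :=
      LinearMap.linearIndependent_of_isOrthoᵢ (B := dotProductBilin ℝ ℝ)
        (fun a b hab => hip a b hab) fun a => (hpos a).ne'
    exact LinearIndependent.of_comp w.homology.subtype hv'
  let bv : Module.Basis _ ℝ w.homology := basisOfLinearIndependentOfCardEqFinrank' v hlin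
    (by rw [hw, finrank_homology_torusLink hn, Fintype.card_prod, Fintype.card_fin,
      Fintype.card_fin])
  have hbv : ∀ a, bv a = v a := fun a => by simp [bv]
  have horth : ∀ a b, a ≠ b → S (bv a) (bv b) = 0 := by
    intro a b hab
    have h := hSv a b
    rw [hip a b hab, mul_zero] at h
    rw [hbv, hbv]
    exact (mul_eq_zero.1 h).resolve_left (mul_pos two_pos (hsin a.2)).ne'
  have h := sigNeg_sub_sigPos_of_basis S hsymm bv horth
  refine h.trans ?_
  rw [← sum_sign_eq_torusSignature hq hn]
  refine Finset.sum_congr rfl fun a _ => ?_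
  have hr := mul_pos two_pos (hsin a.2)
  have h1 := hSv a a
  rw [mul_assoc 2 (cos _ - _)] at h1
  have hneg : S (v a) (v a) < 0 ↔
      cos (π * (a.1 + 1 : ℕ) / q) < sin (π * ((a.2 + 1 : ℕ) : ℤ) / n) := by
    rw [← mul_lt_mul_iff_right₀ hr, h1, mul_zero, ← sub_neg (a := cos _), ← neg_pos,
      ← neg_pos (a := cos _ - _), ← mul_neg, mul_pos_iff_of_pos_left two_pos, ← neg_mul,
      mul_pos_iff_of_pos_right (hpos a)]
  have hpos' : 0 < S (v a) (v a) ↔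
      sin (π * ((a.2 + 1 : ℕ) : ℤ) / n) < cos (π * (a.1 + 1 : ℕ) / q) := by
    rw [← mul_pos_iff_of_pos_left hr, h1, mul_pos_iff_of_pos_left two_pos,
      mul_pos_iff_of_pos_right (hpos a), sub_pos]
  rw [hbv, if_congr hneg rfl rfl, if_congr hpos' rfl rfl, Int.cast_natCast]

end

theorem lemma3p4 (q n : ℕ) (hq : 1 ≤ q) (hqn : q ≤ n) :
    ((q : ℝ) - 1) * (n : ℝ) / 2 ≤ ((torusLink q n).signature : ℝ) ∧
      ((torusLink q n).signature : ℝ) ≤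
        (q : ℝ) * ((n : ℝ) + 1) / 2 - aTerm q - bTerm q n := by
  obtain ⟨h1, h2⟩ := torusSignature_bounds q n hq hqn
  rw [signature_torusLink hq (hq.trans hqn)]
  have h1' : ((q : ℝ) - 1) * n ≤ 2 * torusSignature q n := by exact_mod_cast h1
  have h2' : 2 * (torusSignature q n : ℝ) ≤ q * (n + 1) - (if Odd q then 2 else 4)
      - (if Odd q ∧ Even n then 1 else 0) := by exact_mod_cast h2
  rw [aTerm, bTerm]
  constructor
  · linarith
  · split_ifs at h2' ⊢ <;> linarith
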